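/- **Setting.** Let $(\Omega,\mathcal F,\nu)$ be a $\sigma$-finite measure space (for instance a probability space, or a finite set with counting measure), let $\mathcal P=L^\infty(\Omega,\nu)$ be the algebra of multiplication operators on $L^2(\Omega,\nu)$, with trace $\mathrm{Tr}\,f=\int f\,d\nu$, and let $\mathfrak p\in\mathcal P$ be multiplication by a real function $p\in L^\infty(\Omega,\nu)$. Let $\mathcal M=M_2(\mathbb C)$, $N\ge 1$, $\lambda>0$, $\mathcal W_N=\mathcal M^{\otimes N}$; tensor factors $I$ are omitted. Elements of $\mathcal P\otimes\mathcal M\otimes\mathcal W_N$ are matrix-valued functions of $\omega\in\Omega$, with $^*$, $\exp$, $\log$ taken pointwise, and the trace on $\mathcal P\otimes\mathcal M$ and $\mathcal P\otimes\mathcal M\otimes\mathcal W_N$ is $\mathrm{Tr}\,X=\int\mathrm{tr}\,X(\omega)\,d\nu(\omega)$. For $X\in\mathcal M$ let $X_l=I^{\otimes(l-1)}\otimes X\otimes I^{\otimes(N-l)}\in\mathcal W_N$, and put, with $\sigma_-=\begin{pmatrix}0&0\\1&0\end{pmatrix}$ and $\sigma_+=\sigma_-^*$, $$\Delta A(l)=\lambda(\sigma_-)_l,\quad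 \Delta A(l)^*=\lambda(\sigma_+)_l,\quad \Delta\Lambda(l)=(\sigma_+\sigma_-)_l,\quad \Delta t(l)=\lambda^2 I_l,\quad \Delta W(l)=\Delta A(l)+\Delta A(l)^*.$$ Let $M^{\pm},M^{+},M^{-},M^{\circ}:\mathbb C\to\mathcal M$ be functions such that $\omega\mapsto M^i(p(\omega))$ is measurable and, for $1\le l\le N$, $$M_l=I+M^{\pm}(\mathfrak p)\Delta\Lambda(l)+M^{+}(\mathfrak p)\Delta A(l)^*+M^{-}(\mathfrak p)\Delta A(l)+M^{\circ}(\mathfrak p)\Delta t(l)$$ is unitary, where $M^i(\mathfrak p)$ is the function $\omega\mapsto M^i(p(\omega))$. Let $U(0)=I$, $U(l)=M_lU(l-1)$, $j_l(X)=U(l)^*XU(l)$, $\Delta Y(l)=j_l(\Delta W(l))$, and let $\mathcal Y_l$ be the unital $*$-algebra generated by $\Delta Y(1),\dots,\Delta Y(l)$. Write $|A|^2=A^*A$. Fix $X_{\rm e}\in\mathcal M$, $\mu_1,\mu_2\in\mathbb R$ and estimates $\mathfrak u_l\in\mathcal Y_l$ ($1\le l\le N$), and put $$R(N)=e^{\frac{\mu_1}{2}\lambda^2|j_{N-1}(X_{\rm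 e})-\mathfrak u_{N-1}|^2}\cdots e^{\frac{\mu_1}{2}\lambda^2|j_1(X_{\rm e})-\mathfrak u_1|^2},\qquad R(1)=I.$$ Let $\rho^{\rm true}=\rho_{\rm p}^{\rm true}\otimes\rho_{\rm s}^{\rm true}$ and $\rho^{\rm nom}=\rho_{\rm p}^{\rm nom}\otimes\rho_{\rm s}^{\rm nom}$, where $\rho_{\rm p}^{\rm true},\rho_{\rm p}^{\rm nom}$ are probability densities on $\Omega$ with respect to $\nu$ and $\rho_{\rm s}^{\rm true},\rho_{\rm s}^{\rm nom}\in\mathcal M$ are density matrices (positive semidefinite, trace one). Let $\Phi=(0,1)^{\mathsf T}$ and $$\mathbb P_{\rm true}(X)=\mathrm{Tr}\big[X(\rho^{\rm true}\otimes(\Phi\Phi^*)^{\otimes N})\big],\qquad \mathbb P_{\rm nom}(X)=\mathrm{Tr}\big[X(\rho^{\rm nom}\otimes(\Phi\Phi^*)^{\otimes N})\big].$$ The relative entropy is $R(\rho\|\rho')=\mathrm{Tr}[\rho(\log\rho-\log\rho')]\in(-\infty,+\infty]$ if $\mathrm{supp}\,\rho\subseteq\mathrm{supp}\,\rho'$ (for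 a.e. $\omega$; logarithms are taken to be $0$ on kernels), and $+\infty$ otherwise. **Theorem.** Suppose $R(\rho^{\rm true}\|\rho^{\rm nom})<+\infty$. Then $Z:=R(N)^*e^{\mu_2|j_N(X_{\rm e})-\mathfrak u_N|^2}R(N)$ is positive definite almost everywhere, $\mathbb P_{\rm true}[\log Z]$ and $\mathbb P_{\rm nom}[Z]$ are well defined (their integrands are $\nu$-integrable) and real, $\mathbb P_{\rm nom}[Z]>0$, and $$\mathbb P_{\rm true}\Big[\log\Big(R(N)^*e^{\mu_2|j_N(X_{\rm e})-\mathfrak u_N|^2}R(N)\Big)\Big]\le\log\mathbb P_{\rm nom}\Big[R(N)^*e^{\mu_2|j_N(X_{\rm e})-\mathfrak u_N|^2}R(N)\Big]+R(\rho^{\rm true}\|\rho^{\rm nom}).$$ -/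

import Mathlib

open MeasureTheory Matrix
open scoped Kronecker ComplexOrder

noncomputable section

namespace RiskSensitive

/-- The algebra `ℳ` of a two-level system. -/
abbrev Mat2 : Type := Matrix (Fin 2) (Fin 2) ℂ

/-- The field algebra `𝒲_N = ℳ^{⊗N}`, as matrices over `(ℂ²)^{⊗N}`, whose standard basis is indexed
by `Fin N → Fin 2`. -/
abbrev FieldMat (N : ℕ) : Type := Matrix (Fin N → Fin 2) (Fin N → Fin 2) ℂ

/-- The system-field algebra `ℳ ⊗ 𝒲_N`. -/
abbrev SysField (N : ℕ) : Type := Matrix (Fin 2 × (Fin N → Fin 2)) (Fin 2 × (Fin N → Fin 2)) ℂ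

/-- Elements of `𝒫 ⊗ ℳ ⊗ 𝒲_N`, where `𝒫` is the algebra of multiplication operators on `L²(Ω)`:
such an element is (represented by) a matrix-valued function on `Ω`, with the pointwise
`*`-algebra operations. -/
abbrev TotalAlg (Ω : Type*) (N : ℕ) : Type _ := Ω → SysField N

/-! ### Noises -/

/-- The tensor product `X 0 ⊗ X 1 ⊗ ⋯ ⊗ X (N-1)` of `2 × 2` matrices. -/
def tensorPow {N : ℕ} (X : Fin N → Mat2) : FieldMat N :=
  Matrix.of fun a b => ∏ i, X i (a i) (b i)

/-- `X_l = I^{⊗(l-1)} ⊗ X ⊗ I^{⊗(N-l)}`, for `1 ≤ l ≤ N`. -/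
def slice (N l : ℕ) (X : Mat2) : FieldMat N :=
  tensorPow fun i : Fin N => if (i : ℕ) + 1 = l then X else 1

def sigmaMinus : Mat2 := !![0, 0; 1, 0]

def sigmaPlus : Mat2 := !![0, 1; 0, 0]

/-- `ΔA(l)`. -/
def dA (lam : ℝ) (N l : ℕ) : FieldMat N := (lam : ℂ) • slice N l sigmaMinus

/-- `ΔA(l)^*`. -/
def dAstar (lam : ℝ) (N l : ℕ) : FieldMat N := (lam : ℂ) • slice N l sigmaPlus

/-- `ΔΛ(l)`. -/
def dLambda (N l : ℕ) : FieldMat N := slice N l (sigmaPlus * sigmaMinus)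

/-- `Δt(l)`. -/
def dt (lam : ℝ) (N l : ℕ) : FieldMat N := ((lam : ℂ) ^ 2) • slice N l 1

/-- `ΔW(l) = ΔA(l) + ΔA(l)^*`. -/
def dW (lam : ℝ) (N l : ℕ) : FieldMat N := dA lam N l + dAstar lam N l

/-- The vacuum vector `Φ = [0 1]ᵀ`. -/
def vacuum : Fin 2 → ℂ := ![0, 1]

/-- The vacuum density matrix `(ΦΦ^*)^{⊗N}` of the field. -/
def vacuumDensity (N : ℕ) : FieldMat N :=
  tensorPow fun _ => Matrix.vecMulVec vacuum (star vacuum)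

/-! ### Dynamics with an uncertain parameter -/

/-- The `ℳ`-valued coefficient functions `M^±, M^+, M^-, M^∘` on `ℂ`. -/
structure Coeff where
  gauge : ℂ → Mat2
  plus : ℂ → Mat2
  minus : ℂ → Mat2
  drift : ℂ → Mat2

section Model

variable {Ω : Type*} (M : Coeff) (p : Ω → ℝ) (lam : ℝ) (N : ℕ)

/-- The increment
`M^±(𝔭) ΔΛ(l) + M^+(𝔭) ΔA(l)^* + M^-(𝔭) ΔA(l) + M^∘(𝔭) Δt(l)`,
where the composition `K(𝔭)` of `K : ℂ → ℳ` with the multiplication operator `𝔭` is the function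
`ω ↦ K (p ω)`. -/
def incr (l : ℕ) : TotalAlg Ω N := fun ω =>
  M.gauge (p ω) ⊗ₖ dLambda N l + M.plus (p ω) ⊗ₖ dAstar lam N l
    + M.minus (p ω) ⊗ₖ dA lam N l + M.drift (p ω) ⊗ₖ dt lam N l

/-- The operator `M_l`. -/
def stepOp (l : ℕ) : TotalAlg Ω N := 1 + incr M p lam N l

/-- The solution of the difference equation `ΔU(l) = incr(l) U(l-1)`, `U(0) = I`. -/
def evol : ℕ → TotalAlg Ω N
  | 0 => 1
  | l + 1 => evol l + incr M p lam N (l + 1) * evol l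

/-- The flow `j_l(X) = U(l)^* X U(l)`. -/
def flow (l : ℕ) (X : TotalAlg Ω N) : TotalAlg Ω N :=
  star (evol M p lam N l) * X * evol M p lam N l

/-- A system operator `X ∈ ℳ`, as the element `I ⊗ X ⊗ I` of `𝒫 ⊗ ℳ ⊗ 𝒲_N`. -/
def ofSystem (Ω : Type*) (N : ℕ) (X : Mat2) : TotalAlg Ω N := fun _ => X ⊗ₖ (1 : FieldMat N)

/-- A field operator `X ∈ 𝒲_N`, as the element `I ⊗ I ⊗ X` of `𝒫 ⊗ ℳ ⊗ 𝒲_N`. -/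
def ofField (Ω : Type*) {N : ℕ} (X : FieldMat N) : TotalAlg Ω N := fun _ => (1 : Mat2) ⊗ₖ X

/-- The observation increment `ΔY(l) = U(l)^* ΔW(l) U(l)`. -/
def dY (l : ℕ) : TotalAlg Ω N := flow M p lam N l (ofField Ω (dW lam N l))

/-- The observation algebra `𝒴_l`, the unital `*`-algebra generated by `ΔY(1), …, ΔY(l)`. -/
def obsAlg (l : ℕ) : StarSubalgebra ℂ (TotalAlg Ω N) :=
  StarAlgebra.adjoin ℂ {Y | ∃ i, 1 ≤ i ∧ i ≤ l ∧ Y = dY M p lam N i}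

end Model

/-! ### The risk-sensitive cost operator -/

/-- The exponential in `𝒫 ⊗ ℳ ⊗ 𝒲_N`. -/
def opExp {Ω : Type*} {N : ℕ} (X : TotalAlg Ω N) : TotalAlg Ω N := fun ω => NormedSpace.exp (X ω)

/-- The logarithm (functional calculus) of a positive element of `𝒫 ⊗ ℳ ⊗ 𝒲_N`. -/
def opLog {Ω : Type*} {N : ℕ} (X : TotalAlg Ω N) : TotalAlg Ω N := fun ω => cfc Real.log (X ω)

/-- `|X|² = X^* X`. -/
def absSq {Ω : Type*} {N : ℕ} (X : TotalAlg Ω N) : TotalAlg Ω N := star X * X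

section Cost

variable {Ω : Type*} (M : Coeff) (p : Ω → ℝ) (lam : ℝ) (N : ℕ) (Xe : Mat2) (u : ℕ → TotalAlg Ω N)

/-- The squared error `|j_l(X_e) - 𝔲_l|²`. -/
def sqErr (l : ℕ) : TotalAlg Ω N := absSq (flow M p lam N l (ofSystem Ω N Xe) - u l)

/-- `R(l) = exp[(μ₁/2) λ² |j_{l-1}(X_e) - 𝔲_{l-1}|²] ⋯ exp[(μ₁/2) λ² |j_1(X_e) - 𝔲_1|²]`,
`R(0) = R(1) = I`. -/
def riskOp (mu1 : ℝ) : ℕ → TotalAlg Ω N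
  | 0 => 1
  | 1 => 1
  | l + 2 =>
      opExp (((mu1 / 2 * lam ^ 2 : ℝ) : ℂ) • sqErr M p lam N Xe u (l + 1)) * riskOp mu1 (l + 1)

/-- `R(N)^* exp(μ₂ |j_N(X_e) - 𝔲_N|²) R(N)`. -/
def costOp (mu1 mu2 : ℝ) : TotalAlg Ω N :=
  star (riskOp M p lam N Xe u mu1 N) * opExp ((mu2 : ℂ) • sqErr M p lam N Xe u N)
    * riskOp M p lam N Xe u mu1 N

end Cost

/-! ### Density matrices, states and relative entropy

The trace on `𝒫` is integration against the reference measure `ν`. For a finite `Ω` with the counting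
measure, `𝒫` is the algebra of diagonal matrices and this is the usual trace. -/

section Density

variable {Ω : Type*} [MeasurableSpace Ω] (ν : Measure Ω)

/-- `r` is a density matrix in `𝒫`, i.e. a probability density with respect to `ν`. -/
def IsParamDensity (r : Ω → ℝ) : Prop :=
  Integrable r ν ∧ (∀ᵐ ω ∂ν, 0 ≤ r ω) ∧ ∫ ω, r ω ∂ν = 1

/-- `ρ` is a density matrix in `ℳ`. -/
def IsSystemDensity (ρ : Mat2) : Prop := ρ.PosSemidef ∧ ρ.trace = 1

/-- The product density matrix `ρ_p ⊗ ρ_s` in `𝒫 ⊗ ℳ`. -/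
def prodDensity (r : Ω → ℝ) (ρ : Mat2) : Ω → Mat2 := fun ω => (r ω : ℂ) • ρ

/-- The (fibrewise) trace density of `X (ρ ⊗ (ΦΦ^*)^{⊗N})`. -/
def stateDensity {N : ℕ} (ρ : Ω → Mat2) (X : TotalAlg Ω N) : Ω → ℂ := fun ω =>
  (X ω * (ρ ω ⊗ₖ vacuumDensity N)).trace

/-- The state `ℙ(X) = Tr[X (ρ ⊗ (ΦΦ^*)^{⊗N})]` on `𝒫 ⊗ ℳ ⊗ 𝒲_N`. -/
def state {N : ℕ} (ρ : Ω → Mat2) (X : TotalAlg Ω N) : ℂ := ∫ ω, stateDensity ρ X ω ∂ν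

/-- The support of a Hermitian matrix: the span of its eigenvectors with nonzero eigenvalue, which
is its range. -/
def supp (ρ : Mat2) : Submodule ℂ (Fin 2 → ℂ) := LinearMap.range ρ.mulVecLin

/-- The fibrewise trace density `tr[ρ (log ρ - log ρ')]`. As `Real.log 0 = 0`, the logarithm vanishes
on the kernel, which is the convention needed when `supp ρ ⊆ supp ρ'`. -/
def relEntropyDensity (ρ ρ' : Ω → Mat2) : Ω → ℝ := fun ω =>
  ((ρ ω * (cfc Real.log (ρ ω) - cfc Real.log (ρ' ω))).trace).re

open Classical in
/-- The quantum relative entropy `R(ρ‖ρ') = Tr[ρ (log ρ - log ρ')]` of density matrices in `𝒫 ⊗ ℳ` if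
`supp ρ ⊆ supp ρ'`, and `+∞` otherwise. The negative part of `tr[ρ (log ρ - log ρ')]` is always
integrable, so the integral is `+∞` when the integrand is not integrable. -/
def relEntropy (ρ ρ' : Ω → Mat2) : EReal :=
  if (∀ᵐ ω ∂ν, supp (ρ ω) ≤ supp (ρ' ω)) ∧ Integrable (relEntropyDensity ρ ρ') ν then
    ((∫ ω, relEntropyDensity ρ ρ' ω ∂ν : ℝ) : EReal)
  else ⊤

end Density

end RiskSensitive

end

open RiskSensitive

/-! The core is a fibrewise variational bound (`trace_cfc_log_mul_conj_le`). Measuring in the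
eigenbasis of `Z` turns the two states into nonnegative weights `p k`, `q k` at the eigenvalues `z
k`, so both traces become classical sums. Summing `log u ≤ u - 1` at `u = z k * q k / (p k * c)`,
weighted by `p k`, leaves the classical relative entropy of `p` and `q`, which the quantum one
dominates.

That domination (`sum_mul_log_div_le`) is monotonicity under a measurement. Writing the logarithm as
an integral of resolvents reduces it to an inequality for each `t > 0`, which follows by completing
squares and Bessel's inequality (`sum_sq_div_le_sum_sq_div`).

The vacuum enters through an isometry `V` with `ρ ⊗ (ΦΦ^*)^{⊗N} = V ρ V^*`, so it adds no entropy.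
With `c` fixed, the bound contains no logarithm of a fibrewise expectation: it can be integrated
over `Ω` with the constant `c = ℙ_nom[Z]`. Integrability holds because `Z` and its inverse are
essentially bounded (`costOp_spec`), hence so is `log Z`. -/

/-! ### Logarithms from resolvents -/

section Scalar

open Filter Topology

variable {ι κ : Type*} [Fintype ι] [Fintype κ]

/-- A comparison of weighted resolvents integrates to a comparison of weighted logarithms. -/
theorem sum_mul_log_le_of_resolvent_le {w x : ι → ℝ} {v y : κ → ℝ}
    (hx : ∀ i, w i ≠ 0 → 0 < x i) (hy : ∀ k, v k ≠ 0 → 0 < y k)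
    (hsum : ∑ i, w i = ∑ k, v k)
    (hres : ∀ t, 0 < t → ∑ k, v k / (y k + t) ≤ ∑ i, w i / (x i + t)) :
    ∑ i, w i * Real.log (x i) ≤ ∑ k, v k * Real.log (y k) := by
  have hderiv : ∀ {c z : ℝ}, (c ≠ 0 → 0 < z) → ∀ t, 0 ≤ t →
      HasDerivAt (fun t => c * Real.log (z + t)) (c / (z + t)) t := by
    intro c z hz t ht
    by_cases hc : c = 0
    · simpa [hc] using hasDerivAt_const t (0 : ℝ)
    · have hpos : z + t ≠ 0 := (add_pos_of_pos_of_nonneg (hz hc) ht).ne'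
      have h := (((hasDerivAt_id' t).const_add z).log hpos).const_mul c
      rwa [mul_one_div] at h
  set h : ℝ → ℝ := fun t =>
    ∑ i, w i * Real.log (x i + t) - ∑ k, v k * Real.log (y k + t) with hh
  have hd : ∀ t, 0 ≤ t →
      HasDerivAt h (∑ i, w i / (x i + t) - ∑ k, v k / (y k + t)) t := fun t ht =>
    (HasDerivAt.fun_sum fun i _ => hderiv (hx i) t ht).sub
      (HasDerivAt.fun_sum fun k _ => hderiv (hy k) t ht)
  have hmono : MonotoneOn h (Set.Ici 0) := by
    refine monotoneOn_of_deriv_nonneg (convex_Ici 0)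
      (fun t ht => (hd t ht).continuousAt.continuousWithinAt) ?_ ?_
    · intro t ht
      rw [interior_Ici] at ht
      exact (hd t (le_of_lt ht)).differentiableAt.differentiableWithinAt
    · intro t ht
      rw [interior_Ici] at ht
      rw [(hd t (le_of_lt ht)).deriv]
      exact sub_nonneg.2 (hres t ht)
  -- Equal total weights allow `log t` to be subtracted from every logarithm. As `h` increases to
  -- the limit `0`, it follows that `h 0 ≤ 0`.
  have hlim : Tendsto h atTop (𝓝 0) := by
    have hw : Tendsto (fun t => ∑ i, w i * (Real.log (t + x i) - Real.log t)) atTop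
        (𝓝 (∑ i, w i * 0)) :=
      tendsto_finsetSum _ fun i _ => (Real.tendsto_log_comp_add_sub_log (x i)).const_mul _
    have hv : Tendsto (fun t => ∑ k, v k * (Real.log (t + y k) - Real.log t)) atTop
        (𝓝 (∑ k, v k * 0)) :=
      tendsto_finsetSum _ fun k _ => (Real.tendsto_log_comp_add_sub_log (y k)).const_mul _
    have := hw.sub hv
    simp only [mul_zero, Finset.sum_const_zero, sub_zero] at this
    refine this.congr fun t => ?_
    simp only [hh, mul_sub, Finset.sum_sub_distrib, ← Finset.sum_mul, hsum, add_comm t]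
    ring
  have h0 : h 0 ≤ 0 := ge_of_tendsto hlim <| (eventually_ge_atTop 0).mono fun t ht =>
    hmono (Set.mem_Ici.2 le_rfl) ht ht
  simpa [hh] using h0

end Scalar

/-! ### Monotonicity of relative entropy under a measurement -/

section Resolvent

variable {ι κ : Type*} [Fintype ι] [DecidableEq ι] [Fintype κ]

/-- Bessel's inequality for the orthonormal rows of `P`. -/
theorem sum_norm_sq_vecMul_conjTranspose_le {P : Matrix ι κ ℂ} (hP : P * Pᴴ = 1) (y : κ → ℂ) :
    ∑ i, ‖(y ᵥ* Pᴴ) i‖ ^ 2 ≤ ∑ k, ‖y k‖ ^ 2 := by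
  have hon : Orthonormal ℂ fun i => WithLp.toLp 2 (P i) := by
    rw [orthonormal_iff_ite]
    intro i j
    have := congrFun (congrFun hP j) i
    simp only [mul_apply, conjTranspose_apply, one_apply] at this
    rw [EuclideanSpace.inner_eq_star_dotProduct]
    simp only [dotProduct, Pi.star_apply]
    rw [this]
    simp [eq_comm]
  have hb := hon.sum_inner_products_le (WithLp.toLp 2 y) (s := Finset.univ)
  rw [EuclideanSpace.norm_sq_eq] at hb
  refine le_trans (le_of_eq (Finset.sum_congr rfl fun i _ => ?_)) hb
  rw [EuclideanSpace.inner_eq_star_dotProduct]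
  rfl

/-- The resolvent form of the monotonicity of quantum relative entropy under a measurement. -/
theorem sum_sq_div_le_sum_sq_div {G : Matrix ι ι ℂ} {P P' : Matrix ι κ ℂ} (hPG : P = G * P')
    (hP : P * Pᴴ = 1) (hP' : P' * P'ᴴ = 1) {a b : ι → ℝ} (ha : ∀ i, 0 ≤ a i) (hb : ∀ j, 0 ≤ b j)
    {t : ℝ} (ht : 0 < t) :
    ∑ k, (∑ i, a i * ‖P i k‖ ^ 2) ^ 2 / ((∑ j, b j * ‖P' j k‖ ^ 2) + t * ∑ i, a i * ‖P i k‖ ^ 2) ≤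
      ∑ i, ∑ j, ‖G i j‖ ^ 2 * a i ^ 2 / (b j + t * a i) := by
  set p : κ → ℝ := fun k => ∑ i, a i * ‖P i k‖ ^ 2 with hp
  set q : κ → ℝ := fun k => ∑ j, b j * ‖P' j k‖ ^ 2 with hq
  -- The maximiser of `2 * x * p k - x ^ 2 * (q k + t * p k)`, whose maximum is the `k`-th term on
  -- the left.
  set x : κ → ℝ := fun k => p k / (q k + t * p k) with hx
  have hp0 : ∀ k, 0 ≤ p k := fun k =>
    Finset.sum_nonneg fun i _ => mul_nonneg (ha i) (sq_nonneg _)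
  have hq0 : ∀ k, 0 ≤ q k := fun k =>
    Finset.sum_nonneg fun i _ => mul_nonneg (hb i) (sq_nonneg _)
  -- Matrix elements, between the two eigenbases, of the observable with value `x k` on outcome `k`.
  let d : ι → ι → ℂ := fun i j => ∑ k, P' j k * x k * star (P i k)
  have hbes : ∀ j, ∑ i, ‖d i j‖ ^ 2 ≤ ∑ k, x k ^ 2 * ‖P' j k‖ ^ 2 := by
    intro j
    refine (sum_norm_sq_vecMul_conjTranspose_le hP fun k => P' j k * x k).trans (le_of_eq ?_)
    refine Finset.sum_congr rfl fun k _ => ?_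
    rw [norm_mul, mul_pow, Complex.norm_real, Real.norm_eq_abs, sq_abs, mul_comm]
  have hbes' : ∀ i, ∑ j, ‖d i j‖ ^ 2 ≤ ∑ k, x k ^ 2 * ‖P i k‖ ^ 2 := by
    intro i
    have h := sum_norm_sq_vecMul_conjTranspose_le hP' fun k => P i k * x k
    calc ∑ j, ‖d i j‖ ^ 2 = ∑ j, ‖((fun k => P i k * x k) ᵥ* P'ᴴ) j‖ ^ 2 := by
          refine Finset.sum_congr rfl fun j _ => ?_
          rw [← norm_star (d i j)]
          simp only [d, star_sum, star_mul', star_star, vecMul, dotProduct, conjTranspose_apply]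
          congr 2
          refine Finset.sum_congr rfl fun k _ => ?_
          rw [show star (x k : ℂ) = x k from Complex.conj_ofReal _]
          ring
      _ ≤ _ := h
      _ = _ := by
        refine Finset.sum_congr rfl fun k _ => ?_
        rw [norm_mul, mul_pow, Complex.norm_real, Real.norm_eq_abs, sq_abs, mul_comm]
  have hdiag : ∀ i, ∑ j, (G i j * d i j).re = ∑ k, x k * ‖P i k‖ ^ 2 := by
    intro i
    have : ∑ j, G i j * d i j = ((∑ k, x k * ‖P i k‖ ^ 2 : ℝ) : ℂ) := by
      simp only [d, Finset.mul_sum]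
      rw [Finset.sum_comm]
      push_cast
      refine Finset.sum_congr rfl fun k _ => ?_
      have hk : P i k = ∑ j, G i j * P' j k := by rw [hPG, mul_apply]
      calc ∑ j, G i j * (P' j k * x k * star (P i k))
          = (∑ j, G i j * P' j k) * star (P i k) * x k := by
            rw [Finset.sum_mul, Finset.sum_mul]
            exact Finset.sum_congr rfl fun j _ => by ring
        _ = x k * (‖P i k‖ : ℂ) ^ 2 := by
            rw [← hk, mul_comm, show star (P i k) = (starRingEnd ℂ) (P i k) from rfl,
              Complex.mul_conj']
    rw [← Complex.re_sum, this, Complex.ofReal_re]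
  have hterm : ∀ i j, 2 * (a i * (G i j * d i j).re) - (b j + t * a i) * ‖d i j‖ ^ 2 ≤
      ‖G i j‖ ^ 2 * a i ^ 2 / (b j + t * a i) := by
    intro i j
    have hre : (G i j * d i j).re ≤ ‖G i j‖ * ‖d i j‖ := by
      rw [← norm_mul]; exact Complex.re_le_norm _
    have hre' := mul_le_mul_of_nonneg_left hre (ha i)
    have hta := mul_nonneg ht.le (ha i)
    -- If the denominator vanishes then so does `a i`, and both sides are `0`; otherwise this is a
    -- completed square.
    rcases (add_nonneg (hb j) hta).eq_or_lt with h0 | h0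
    · have ha0 : a i = 0 := by
        have : t * a i = 0 := by linarith [hb j]
        exact (mul_eq_zero.1 this).resolve_left ht.ne'
      rw [← h0, ha0]; simp
    · rw [le_div_iff₀ h0]
      nlinarith [sq_nonneg (‖G i j‖ * a i - (b j + t * a i) * ‖d i j‖)]
  calc ∑ k, p k ^ 2 / (q k + t * p k)
      = ∑ k, (2 * (x k * p k) - x k ^ 2 * (q k + t * p k)) := by
        refine Finset.sum_congr rfl fun k _ => ?_
        simp only [hx]
        rcases (add_nonneg (hq0 k) (mul_nonneg ht.le (hp0 k))).eq_or_lt with h0 | h0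
        · rw [← h0]; simp
        · field_simp; ring
    _ = 2 * ∑ i, a i * ∑ k, x k * ‖P i k‖ ^ 2 - ∑ j, b j * ∑ k, x k ^ 2 * ‖P' j k‖ ^ 2
        - t * ∑ i, a i * ∑ k, x k ^ 2 * ‖P i k‖ ^ 2 := by
        simp only [hp, hq, mul_add, Finset.mul_sum, Finset.sum_sub_distrib, Finset.sum_add_distrib]
        rw [Finset.sum_comm (s := (Finset.univ : Finset κ)),
          Finset.sum_comm (s := (Finset.univ : Finset κ)) (f := fun k j =>
            x k ^ 2 * (b j * ‖P' j k‖ ^ 2)),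
          Finset.sum_comm (s := (Finset.univ : Finset κ)) (f := fun k i =>
            x k ^ 2 * (t * (a i * ‖P i k‖ ^ 2))), sub_sub]
        congr 1
        · exact Finset.sum_congr rfl fun i _ => Finset.sum_congr rfl fun k _ => by ring
        · congr 1
          · exact Finset.sum_congr rfl fun i _ => Finset.sum_congr rfl fun k _ => by ring
          · exact Finset.sum_congr rfl fun i _ => Finset.sum_congr rfl fun k _ => by ring
    _ ≤ 2 * ∑ i, a i * ∑ j, (G i j * d i j).re - ∑ j, b j * ∑ i, ‖d i j‖ ^ 2
        - t * ∑ i, a i * ∑ j, ‖d i j‖ ^ 2 := by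
        simp only [hdiag]
        have h1 := Finset.sum_le_sum fun j (_ : j ∈ Finset.univ) =>
          mul_le_mul_of_nonneg_left (hbes j) (hb j)
        have h2 := mul_le_mul_of_nonneg_left (Finset.sum_le_sum fun i (_ : i ∈ Finset.univ) =>
          mul_le_mul_of_nonneg_left (hbes' i) (ha i)) ht.le
        linarith
    _ = ∑ i, ∑ j, (2 * (a i * (G i j * d i j).re) - (b j + t * a i) * ‖d i j‖ ^ 2) := by
        simp only [add_mul, Finset.mul_sum, Finset.sum_sub_distrib, Finset.sum_add_distrib]
        rw [Finset.sum_comm (f := fun j i => b j * ‖d i j‖ ^ 2), sub_sub]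
        simp only [mul_assoc]
    _ ≤ _ := Finset.sum_le_sum fun i _ => Finset.sum_le_sum fun j _ => hterm i j

omit [Fintype ι] in
theorem sum_norm_sq_row {Q : Matrix ι κ ℂ} (hQ : Q * Qᴴ = 1) (i : ι) : ∑ k, ‖Q i k‖ ^ 2 = 1 := by
  have h := congrFun (congrFun hQ i) i
  simp only [mul_apply, conjTranspose_apply, one_apply_eq] at h
  have h' : ((∑ k, ‖Q i k‖ ^ 2 : ℝ) : ℂ) = 1 := by
    rw [← h]; push_cast
    exact Finset.sum_congr rfl fun k _ => (Complex.mul_conj' _).symm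
  exact_mod_cast h'

/-- Monotonicity of relative entropy under a measurement, in spectral coordinates: `a`, `b` are the
eigenvalues of the two states, `G` is the change of eigenbasis, and the rows of `P`, `P'` hold the
amplitudes of the outcomes. -/
theorem sum_mul_log_div_le {G : Matrix ι ι ℂ} {P P' : Matrix ι κ ℂ} (hPG : P = G * P')
    (hG : G * Gᴴ = 1)
    (hP : P * Pᴴ = 1) (hP' : P' * P'ᴴ = 1) {a b : ι → ℝ} (ha : ∀ i, 0 ≤ a i) (hb : ∀ j, 0 ≤ b j)
    (hab : ∀ i j, G i j ≠ 0 → a i ≠ 0 → b j ≠ 0) :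
    (∀ k, ∑ i, a i * ‖P i k‖ ^ 2 ≠ 0 → 0 < ∑ j, b j * ‖P' j k‖ ^ 2) ∧
    ∑ i, ∑ j, ‖G i j‖ ^ 2 * a i * (Real.log (b j) - Real.log (a i)) ≤
      ∑ k, (∑ i, a i * ‖P i k‖ ^ 2) *
        Real.log ((∑ j, b j * ‖P' j k‖ ^ 2) / ∑ i, a i * ‖P i k‖ ^ 2) := by
  have hpos : ∀ k, ∑ i, a i * ‖P i k‖ ^ 2 ≠ 0 → 0 < ∑ j, b j * ‖P' j k‖ ^ 2 := by
    intro k hk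
    obtain ⟨i, -, hi⟩ := Finset.exists_ne_zero_of_sum_ne_zero hk
    have hai := left_ne_zero_of_mul hi
    have hPi : P i k ≠ 0 := fun h => hi (by simp [h])
    rw [hPG, mul_apply] at hPi
    obtain ⟨j, -, hj⟩ := Finset.exists_ne_zero_of_sum_ne_zero hPi
    have hbj := hab i j (left_ne_zero_of_mul hj) hai
    refine Finset.sum_pos' (fun j _ => mul_nonneg (hb j) (sq_nonneg _)) ⟨j, Finset.mem_univ _, ?_⟩
    exact mul_pos ((hb j).lt_of_ne' hbj) (pow_pos (norm_pos_iff.2 (right_ne_zero_of_mul hj)) 2)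
  refine ⟨hpos, ?_⟩
  have hp0 : ∀ k, 0 ≤ ∑ i, a i * ‖P i k‖ ^ 2 := fun k =>
    Finset.sum_nonneg fun i _ => mul_nonneg (ha i) (sq_nonneg _)
  -- The ratios `b j / a i` are the eigenvalues of the relative modular operator, with spectral
  -- weights `‖G i j‖ ^ 2 * a i`; the outcomes carry the classical likelihood ratios, with weights
  -- `p k`.
  have key := sum_mul_log_le_of_resolvent_le
    (w := fun ij : ι × ι => ‖G ij.1 ij.2‖ ^ 2 * a ij.1) (x := fun ij => b ij.2 / a ij.1)
    (v := fun k => ∑ i, a i * ‖P i k‖ ^ 2)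
    (y := fun k => (∑ j, b j * ‖P' j k‖ ^ 2) / ∑ i, a i * ‖P i k‖ ^ 2) ?_ ?_ ?_ ?_
  · refine le_trans (le_of_eq ?_) key
    rw [Fintype.sum_prod_type]
    refine Finset.sum_congr rfl fun i _ => Finset.sum_congr rfl fun j _ => ?_
    by_cases h : ‖G i j‖ ^ 2 * a i = 0
    · simp [h]
    · have hai := right_ne_zero_of_mul h
      have hGij : G i j ≠ 0 := fun h0 => h (by simp [h0])
      rw [Real.log_div (hab i j hGij hai) hai]
  · rintro ⟨i, j⟩ h
    have hai := right_ne_zero_of_mul h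
    have hGij : G i j ≠ 0 := fun h0 => h (by simp [h0])
    exact div_pos ((hb j).lt_of_ne' (hab i j hGij hai)) ((ha i).lt_of_ne' hai)
  · intro k hk
    exact div_pos (hpos k hk) ((hp0 k).lt_of_ne' hk)
  · rw [Fintype.sum_prod_type, Finset.sum_comm (s := (Finset.univ : Finset κ))]
    refine Finset.sum_congr rfl fun i _ => ?_
    change ∑ j, ‖G i j‖ ^ 2 * a i = _
    rw [← Finset.sum_mul, sum_norm_sq_row hG, ← Finset.mul_sum, sum_norm_sq_row hP]
    ring
  · intro t ht
    have hdiv : ∀ {c d : ℝ}, c / (d / c + t) = c ^ 2 / (d + t * c) := by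
      intro c d
      by_cases hc : c = 0
      · simp [hc]
      · rw [show d + t * c = (d / c + t) * c by field_simp, sq, mul_div_mul_right _ _ hc]
    refine le_trans (le_of_eq ?_)
      ((sum_sq_div_le_sum_sq_div hPG hP hP' ha hb ht).trans (le_of_eq ?_))
    · exact Finset.sum_congr rfl fun k _ => hdiv
    · rw [Fintype.sum_prod_type]
      refine Finset.sum_congr rfl fun i _ => Finset.sum_congr rfl fun j _ => ?_
      rw [mul_div_assoc, mul_div_assoc, hdiv]

end Resolvent

/-! ### The fibrewise variational bound -/

section Spectral

variable {n m ι κ : Type*} [Fintype n] [DecidableEq n] [Fintype m] [DecidableEq m] [Fintype ι]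
  [DecidableEq ι] [Fintype κ] [DecidableEq κ]

theorem Matrix.IsHermitian.cfc_eq_mul_diagonal_mul {A : Matrix n n ℂ} (hA : A.IsHermitian)
    (f : ℝ → ℝ) :
    cfc f A = (hA.eigenvectorUnitary : Matrix n n ℂ) *
      diagonal (fun i => (f (hA.eigenvalues i) : ℂ)) *
      (hA.eigenvectorUnitary : Matrix n n ℂ)ᴴ := by
  rw [hA.cfc_eq, Matrix.IsHermitian.cfc, Unitary.conjStarAlgAut_apply]
  rfl

theorem Matrix.IsHermitian.eq_mul_diagonal_mul {A : Matrix n n ℂ} (hA : A.IsHermitian) :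
    A = (hA.eigenvectorUnitary : Matrix n n ℂ) * diagonal (fun i => (hA.eigenvalues i : ℂ)) *
      (hA.eigenvectorUnitary : Matrix n n ℂ)ᴴ := by
  conv_lhs => rw [hA.spectral_theorem, Unitary.conjStarAlgAut_apply]
  rfl

omit [DecidableEq n] in
theorem trace_mul_diagonal_mul (A : Matrix n ι ℂ) (B : Matrix n κ ℂ) (a : ι → ℝ) (b : κ → ℝ) :
    (B * diagonal (fun j => (b j : ℂ)) * Bᴴ * (A * diagonal (fun i => (a i : ℂ)) * Aᴴ)).trace =
      ((∑ i, ∑ j, a i * b j * ‖(Aᴴ * B) i j‖ ^ 2 : ℝ) : ℂ) := by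
  have h : (B * diagonal (fun j => (b j : ℂ)) * Bᴴ *
      (A * diagonal (fun i => (a i : ℂ)) * Aᴴ)).trace =
      (diagonal (fun i => (a i : ℂ)) * ((Aᴴ * B) * (diagonal (fun j => (b j : ℂ)) *
        (Aᴴ * B)ᴴ))).trace := by
    rw [trace_mul_comm, conjTranspose_mul, conjTranspose_conjTranspose]
    simp only [Matrix.mul_assoc]
    rw [trace_mul_comm A]
    simp only [Matrix.mul_assoc]
  rw [h]
  simp only [trace, diag_apply, diagonal_mul]
  push_cast
  refine Finset.sum_congr rfl fun i _ => ?_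
  rw [mul_apply, Finset.mul_sum]
  refine Finset.sum_congr rfl fun j _ => ?_
  rw [diagonal_mul, conjTranspose_apply, ← Complex.mul_conj' ((Aᴴ * B) i j)]
  change _ = _ * (_ * star ((Aᴴ * B) i j))
  ring

/-- Diagonalising `A` and `Z` exhibits the trace as the sum of `f` over the outcomes of measuring
`Z`, weighted by the diagonal of `V A V^*` in the eigenbasis of `Z`. In particular it is real. -/
theorem trace_cfc_mul_conj_eq {A : Matrix n n ℂ} (hA : A.IsHermitian)
    {Z : Matrix m m ℂ} (hZ : Z.IsHermitian) (V : Matrix m n ℂ) (f : ℝ → ℝ) :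
    (cfc f Z * (V * A * Vᴴ)).trace =
      ((∑ k, (∑ i, hA.eigenvalues i * ‖((V * (hA.eigenvectorUnitary : Matrix n n ℂ))ᴴ *
        (hZ.eigenvectorUnitary : Matrix m m ℂ)) i k‖ ^ 2) * f (hZ.eigenvalues k) : ℝ) : ℂ) := by
  have hVA : V * A * Vᴴ = (V * (hA.eigenvectorUnitary : Matrix n n ℂ)) *
      diagonal (fun i => (hA.eigenvalues i : ℂ)) *
      (V * (hA.eigenvectorUnitary : Matrix n n ℂ))ᴴ := by
    conv_lhs => rw [hA.eq_mul_diagonal_mul]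
    simp only [conjTranspose_mul, Matrix.mul_assoc]
  rw [hVA, hZ.cfc_eq_mul_diagonal_mul, trace_mul_diagonal_mul]
  congr 1
  rw [Finset.sum_comm]
  refine Finset.sum_congr rfl fun k _ => ?_
  rw [Finset.sum_mul]
  exact Finset.sum_congr rfl fun i _ => by ring

theorem trace_mul_conj_eq {A : Matrix n n ℂ} (hA : A.IsHermitian)
    {Z : Matrix m m ℂ} (hZ : Z.IsHermitian) (V : Matrix m n ℂ) :
    (Z * (V * A * Vᴴ)).trace =
      ((∑ k, (∑ i, hA.eigenvalues i * ‖((V * (hA.eigenvectorUnitary : Matrix n n ℂ))ᴴ *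
        (hZ.eigenvectorUnitary : Matrix m m ℂ)) i k‖ ^ 2) * hZ.eigenvalues k : ℝ) : ℂ) := by
  have h := trace_cfc_mul_conj_eq hA hZ V id
  have hid : cfc (id : ℝ → ℝ) Z = Z := cfc_id ℝ Z hZ
  rwa [hid] at h

/-- The variational bound for relative entropy, with the normalisation `c` left free: for
`tr ρ = 1` and `c = tr (Z V σ V^*)` it reads
`tr (log Z V ρ V^*) ≤ log tr (Z V σ V^*) + tr (ρ (log ρ - log σ))`. -/
theorem trace_cfc_log_mul_conj_le {ρ σ : Matrix n n ℂ} (hρ : ρ.PosSemidef) (hσ : σ.PosSemidef)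
    {K : Matrix n n ℂ} (hK : ρ = σ * K) {V : Matrix m n ℂ} (hV : Vᴴ * V = 1)
    {Z : Matrix m m ℂ} (hZ : Z.PosDef) {c : ℝ} (hc : 0 < c) :
    (cfc Real.log Z * (V * ρ * Vᴴ)).trace.re ≤
      (Z * (V * σ * Vᴴ)).trace.re / c - ρ.trace.re + ρ.trace.re * Real.log c +
        (ρ * (cfc Real.log ρ - cfc Real.log σ)).trace.re := by
  set X : Matrix n n ℂ := (hρ.1.eigenvectorUnitary : Matrix n n ℂ) with hX
  set Y : Matrix n n ℂ := (hσ.1.eigenvectorUnitary : Matrix n n ℂ) with hY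
  set W : Matrix m m ℂ := (hZ.1.eigenvectorUnitary : Matrix m m ℂ) with hW
  have hXX : Xᴴ * X = 1 := (Unitary.mem_iff.1 hρ.1.eigenvectorUnitary.2).1
  have hYY : Yᴴ * Y = 1 := (Unitary.mem_iff.1 hσ.1.eigenvectorUnitary.2).1
  have hYY' : Y * Yᴴ = 1 := (Unitary.mem_iff.1 hσ.1.eigenvectorUnitary.2).2
  have hWW' : W * Wᴴ = 1 := (Unitary.mem_iff.1 hZ.1.eigenvectorUnitary.2).2
  set a := hρ.1.eigenvalues with ha
  set b := hσ.1.eigenvalues with hb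
  set z := hZ.1.eigenvalues with hz
  have ha0 : ∀ i, 0 ≤ a i := hρ.eigenvalues_nonneg
  have hb0 : ∀ i, 0 ≤ b i := hσ.eigenvalues_nonneg
  have hz0 : ∀ k, 0 < z k := hZ.eigenvalues_pos
  set G := Xᴴ * Y with hGdef
  set P := (V * X)ᴴ * W with hPdef
  set P' := (V * Y)ᴴ * W with hP'def
  have hiso : ∀ {Q : Matrix n n ℂ}, Qᴴ * Q = 1 → ((V * Q)ᴴ * W) * ((V * Q)ᴴ * W)ᴴ = 1 := by
    intro Q hQ
    calc ((V * Q)ᴴ * W) * ((V * Q)ᴴ * W)ᴴ = Qᴴ * (Vᴴ * (W * Wᴴ) * V) * Q := by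
          simp only [conjTranspose_mul, conjTranspose_conjTranspose, Matrix.mul_assoc]
      _ = 1 := by rw [hWW', Matrix.mul_one, hV, Matrix.mul_one, hQ]
  have hPG : P = G * P' := by
    calc P = Xᴴ * (1 : Matrix n n ℂ) * Vᴴ * W := by
          rw [hPdef, conjTranspose_mul, Matrix.mul_one]
      _ = G * P' := by
        rw [← hYY', hGdef, hP'def, conjTranspose_mul]
        simp only [Matrix.mul_assoc]
  have hGG : G * Gᴴ = 1 := by
    calc G * Gᴴ = Xᴴ * (Y * Yᴴ) * X := by
          simp only [hGdef, conjTranspose_mul, conjTranspose_conjTranspose, Matrix.mul_assoc]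
      _ = 1 := by rw [hYY', Matrix.mul_one, hXX]
  -- The factorisation `ρ = σ * K` encodes the support condition: computing the entry `(j, i)` of
  -- `Yᴴ * ρ * X` from either side gives `star (G i j) * a i` and a multiple of `b j`.
  have hab : ∀ i j, G i j ≠ 0 → a i ≠ 0 → b j ≠ 0 := by
    intro i j hG hai hbj
    have h1 : Yᴴ * ρ * X = Gᴴ * diagonal (fun i => (a i : ℂ)) := by
      conv_lhs => rw [hρ.1.eq_mul_diagonal_mul]
      calc Yᴴ * (X * diagonal (fun i => (a i : ℂ)) * Xᴴ) * X
          = Yᴴ * X * diagonal (fun i => (a i : ℂ)) * (Xᴴ * X) := by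
            simp only [Matrix.mul_assoc]
        _ = _ := by
            rw [hXX, Matrix.mul_one, hGdef, conjTranspose_mul, conjTranspose_conjTranspose]
    have h2 : Yᴴ * ρ * X = diagonal (fun i => (b i : ℂ)) * (Yᴴ * K * X) := by
      rw [hK]
      conv_lhs => rw [hσ.1.eq_mul_diagonal_mul]
      calc Yᴴ * (Y * diagonal (fun i => (b i : ℂ)) * Yᴴ * K) * X
          = (Yᴴ * Y) * diagonal (fun i => (b i : ℂ)) * (Yᴴ * K * X) := by
            simp only [Matrix.mul_assoc]
        _ = _ := by rw [hYY, Matrix.one_mul]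
    have h3 := congrFun (congrFun (h1.symm.trans h2) j) i
    rw [mul_diagonal, diagonal_mul, hbj, Complex.ofReal_zero, zero_mul, conjTranspose_apply] at h3
    rcases mul_eq_zero.1 h3 with h | h
    · exact hG (star_eq_zero.1 h)
    · exact hai (Complex.ofReal_eq_zero.1 h)
  obtain ⟨hpos, hmono⟩ := sum_mul_log_div_le hPG hGG (hiso hXX) (hiso hYY) ha0 hb0 hab
  set p : m → ℝ := fun k => ∑ i, a i * ‖P i k‖ ^ 2 with hp
  set q : m → ℝ := fun k => ∑ j, b j * ‖P' j k‖ ^ 2 with hq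
  have hp0 : ∀ k, 0 ≤ p k := fun k =>
    Finset.sum_nonneg fun i _ => mul_nonneg (ha0 i) (sq_nonneg _)
  have hq0 : ∀ k, 0 ≤ q k := fun k =>
    Finset.sum_nonneg fun i _ => mul_nonneg (hb0 i) (sq_nonneg _)
  have hlhs : (cfc Real.log Z * (V * ρ * Vᴴ)).trace.re = ∑ k, p k * Real.log (z k) := by
    rw [trace_cfc_mul_conj_eq hρ.1 hZ.1, Complex.ofReal_re]
  have hnom : (Z * (V * σ * Vᴴ)).trace.re = ∑ k, q k * z k := by
    rw [trace_mul_conj_eq hσ.1 hZ.1, Complex.ofReal_re]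
  have htr : ρ.trace.re = ∑ k, p k := by
    rw [hρ.1.trace_eq_sum_eigenvalues]
    simp only [hp]
    rw [Finset.sum_comm, Complex.re_sum]
    refine Finset.sum_congr rfl fun i _ => ?_
    rw [← Finset.mul_sum, sum_norm_sq_row (hiso hXX), mul_one]
    exact Complex.ofReal_re _
  have hent : (ρ * (cfc Real.log ρ - cfc Real.log σ)).trace.re =
      -∑ i, ∑ j, ‖G i j‖ ^ 2 * a i * (Real.log (b j) - Real.log (a i)) := by
    have h1 : (ρ * cfc Real.log ρ).trace.re = ∑ i, a i * Real.log (a i) := by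
      rw [trace_mul_comm]
      conv_lhs => rw [hρ.1.cfc_eq_mul_diagonal_mul]
      conv_lhs => enter [1, 1, 2]; rw [hρ.1.eq_mul_diagonal_mul]
      rw [trace_mul_diagonal_mul, Complex.ofReal_re]
      refine Finset.sum_congr rfl fun i _ => ?_
      rw [Finset.sum_eq_single i]
      · change a i * Real.log (a i) * ‖(Xᴴ * X) i i‖ ^ 2 = _
        simp [hXX]
      · intro j _ hj
        change a i * Real.log (a j) * ‖(Xᴴ * X) i j‖ ^ 2 = _
        simp [hXX, hj.symm]
      · simp
    have h2 : (ρ * cfc Real.log σ).trace.re = ∑ i, ∑ j, a i * Real.log (b j) * ‖G i j‖ ^ 2 := by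
      rw [trace_mul_comm, hσ.1.cfc_eq_mul_diagonal_mul]
      conv_lhs => enter [1, 1, 2]; rw [hρ.1.eq_mul_diagonal_mul]
      rw [trace_mul_diagonal_mul, Complex.ofReal_re]
    rw [mul_sub, trace_sub, Complex.sub_re, h1, h2, ← Finset.sum_sub_distrib,
      ← Finset.sum_neg_distrib]
    refine Finset.sum_congr rfl fun i _ => ?_
    have h3 : a i * Real.log (a i) = ∑ j, ‖G i j‖ ^ 2 * (a i * Real.log (a i)) := by
      rw [← Finset.sum_mul, sum_norm_sq_row hGG, one_mul]
    rw [h3, ← Finset.sum_sub_distrib, ← Finset.sum_neg_distrib]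
    exact Finset.sum_congr rfl fun j _ => by ring
  -- For `p k > 0` this is `log u ≤ u - 1` at `u = z k * (q k / p k) / c`, times `p k`; for `p k =
  -- 0` only `q k * z k / c ≥ 0` remains.
  have hk : ∀ k, p k * Real.log (z k) ≤
      q k * z k / c - p k + p k * Real.log c - p k * Real.log (q k / p k) := by
    intro k
    rcases (hp0 k).eq_or_lt with h0 | h0
    · rw [← h0]
      have := div_nonneg (mul_nonneg (hq0 k) (hz0 k).le) hc.le
      simpa using this
    · have hqk := hpos k h0.ne'
      have h1 := Real.log_le_sub_one_of_pos
        (div_pos (mul_pos (hz0 k) (div_pos hqk h0)) hc)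
      rw [Real.log_div (mul_pos (hz0 k) (div_pos hqk h0)).ne' hc.ne',
        Real.log_mul (hz0 k).ne' (div_pos hqk h0).ne'] at h1
      have h2 := mul_le_mul_of_nonneg_left h1 h0.le
      have h3 : p k * (z k * (q k / p k) / c - 1) = q k * z k / c - p k := by
        field_simp
      rw [h3] at h2
      linarith
  have hsum := Finset.sum_le_sum fun k (_ : k ∈ Finset.univ) => hk k
  rw [Finset.sum_sub_distrib, Finset.sum_add_distrib, Finset.sum_sub_distrib, ← Finset.sum_div,
    ← Finset.sum_mul] at hsum
  rw [hlhs, hnom, htr, hent]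
  linarith

end Spectral

/-! ### Essentially bounded matrix-valued functions -/

section EssBounded

open scoped Matrix.Norms.L2Operator

variable {Ω : Type*} [MeasurableSpace Ω] {n : Type*} [Fintype n] [DecidableEq n]

theorem Matrix.exp_mul_exp_neg (A : Matrix n n ℂ) :
    NormedSpace.exp A * NormedSpace.exp (-A) = 1 := by
  rw [← Matrix.exp_add_of_commute _ _ (Commute.refl A).neg_right, add_neg_cancel,
    NormedSpace.exp_zero]

theorem Matrix.continuous_exp :
    Continuous (NormedSpace.exp : Matrix n n ℂ → Matrix n n ℂ) := by
  let _ : NormedAlgebra ℚ (Matrix n n ℂ) := NormedAlgebra.restrictScalars ℚ ℂ _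
  exact NormedSpace.exp_continuous

variable (n) in
/-- The measurable, essentially bounded matrix-valued functions. -/
def essBounded (ν : Measure Ω) : StarSubalgebra ℂ (Ω → Matrix n n ℂ) where
  carrier := {F | AEStronglyMeasurable F ν ∧ ∃ C : ℝ, ∀ᵐ ω ∂ν, ‖F ω‖ ≤ C}
  mul_mem' := by
    rintro F G ⟨hF, C, hC⟩ ⟨hG, D, hD⟩
    refine ⟨hF.mul hG, C * D, ?_⟩
    filter_upwards [hC, hD] with ω h1 h2
    exact (norm_mul_le _ _).trans
      (mul_le_mul h1 h2 (norm_nonneg _) ((norm_nonneg _).trans h1))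
  add_mem' := by
    rintro F G ⟨hF, C, hC⟩ ⟨hG, D, hD⟩
    refine ⟨hF.add hG, C + D, ?_⟩
    filter_upwards [hC, hD] with ω h1 h2
    exact (norm_add_le _ _).trans (add_le_add h1 h2)
  algebraMap_mem' r :=
    ⟨aestronglyMeasurable_const, ‖algebraMap ℂ (Matrix n n ℂ) r‖, .of_forall fun _ => le_rfl⟩
  star_mem' := by
    rintro F ⟨hF, C, hC⟩
    refine ⟨continuous_star.comp_aestronglyMeasurable hF, C, ?_⟩
    filter_upwards [hC] with ω h
    exact (norm_star _).le.trans h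

variable {ν : Measure Ω}

theorem const_mem_essBounded (A : Matrix n n ℂ) : (fun _ : Ω => A) ∈ essBounded n ν :=
  ⟨aestronglyMeasurable_const, ‖A‖, .of_forall fun _ => le_rfl⟩

theorem exp_mem_essBounded {F : Ω → Matrix n n ℂ} (hF : F ∈ essBounded n ν) :
    (fun ω => NormedSpace.exp (F ω)) ∈ essBounded n ν := by
  obtain ⟨hm, C, hC⟩ := hF
  have : ProperSpace (Matrix n n ℂ) := FiniteDimensional.proper ℂ _
  obtain ⟨D, hD⟩ := ((isCompact_closedBall (0 : Matrix n n ℂ) C).image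
    Matrix.continuous_exp).isBounded.exists_norm_le
  refine ⟨Matrix.continuous_exp.comp_aestronglyMeasurable hm, D, ?_⟩
  filter_upwards [hC] with ω h
  exact hD _ (Set.mem_image_of_mem _ (mem_closedBall_zero_iff.2 h))

theorem mem_essBounded_of_ae_unitary [Nonempty n] {F : Ω → Matrix n n ℂ}
    (hF : AEStronglyMeasurable F ν) (hu : ∀ᵐ ω ∂ν, F ω ∈ unitary (Matrix n n ℂ)) :
    F ∈ essBounded n ν :=
  ⟨hF, 1, hu.mono fun _ h => (CStarRing.norm_of_mem_unitary h).le⟩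

omit [DecidableEq n] in
theorem aestronglyMeasurable_matrix {m : Type*} [Fintype m] {F : Ω → Matrix n m ℂ}
    (hF : ∀ i j, AEMeasurable (fun ω => F ω i j) ν) : AEStronglyMeasurable F ν :=
  AEMeasurable.aestronglyMeasurable (β := n → m → ℂ) <|
    aemeasurable_pi_lambda _ fun i => aemeasurable_pi_lambda _ fun j => hF i j

/-- Passing to the Hermitian part makes the functional calculus continuous on all matrices, so that
it preserves a.e. strong measurability. Near `A`, all the spectra lie in one compact ball. -/
theorem continuous_cfc_hermitianPart {f : ℝ → ℝ} (hf : Continuous f) :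
    Continuous fun A : Matrix n n ℂ => cfc f ((2⁻¹ : ℂ) • (A + star A)) := by
  rcases isEmpty_or_nonempty n with h | h
  · exact continuous_of_const fun _ _ => Subsingleton.elim _ _
  have hc : Continuous fun A : Matrix n n ℂ => (2⁻¹ : ℂ) • (A + star A) :=
    by fun_prop
  refine Continuous.cfc (s := fun A : Matrix n n ℂ =>
    Metric.closedBall (0 : ℝ) (‖(2⁻¹ : ℂ) • (A + star A)‖ + 1)) f hc
    (fun _ => isCompact_closedBall _ _) ?_ (fun _ => hf.continuousOn) ?_
  · intro A
    filter_upwards [hc.norm.continuousAt.eventually_lt continuousAt_const (lt_add_one _)]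
      with B hB x hx
    rw [mem_closedBall_zero_iff]
    exact (spectrum.norm_le_norm_of_mem hx).trans hB.le
  · intro A
    rw [isSelfAdjoint_iff, star_smul, star_add, star_star, add_comm (star A)]
    simp

/-- The logarithm of a positive function with essentially bounded inverse is essentially bounded. -/
theorem cfc_log_mem_essBounded [Nonempty n] {F G : Ω → Matrix n n ℂ} (hF : F ∈ essBounded n ν)
    (hG : G ∈ essBounded n ν) (hFG : F * G = 1) (hpos : ∀ ω, (F ω).PosDef) :
    (fun ω => cfc Real.log (F ω)) ∈ essBounded n ν := by
  obtain ⟨hm, C, hC⟩ := hF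
  obtain ⟨-, D, hD⟩ := hG
  have hspec : ∀ᵐ ω ∂ν, ∀ x ∈ spectrum ℝ (F ω), 0 < D ∧ D⁻¹ ≤ x ∧ x ≤ C := by
    filter_upwards [hC, hD] with ω h1 h2 x hx
    have hx0 : 0 < x := by
      rw [(hpos ω).1.spectrum_real_eq_range_eigenvalues] at hx
      obtain ⟨i, rfl⟩ := hx
      exact (hpos ω).eigenvalues_pos i
    have hFGω : F ω * G ω = 1 := congrFun hFG ω
    have hinv : x⁻¹ ∈ spectrum ℝ (G ω) := by
      have := (spectrum.inv_mem_iff (r := Units.mk0 x hx0.ne')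
        (a := ⟨F ω, G ω, hFGω, mul_eq_one_comm.1 hFGω⟩)).1 hx
      simpa using this
    have h3 := (spectrum.norm_le_norm_of_mem hinv).trans h2
    have h4 := (spectrum.norm_le_norm_of_mem hx).trans h1
    rw [Real.norm_of_nonneg (inv_nonneg.2 hx0.le)] at h3
    rw [Real.norm_of_nonneg hx0.le] at h4
    have hD0 : 0 < D := (inv_pos.2 hx0).trans_le h3
    exact ⟨hD0, inv_le_of_inv_le₀ hx0 h3, h4⟩
  refine ⟨?_, |Real.log D⁻¹| + |Real.log C|, ?_⟩
  · by_cases hD0 : 0 < D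
    -- The bound `D` on the inverse keeps the spectrum above `D⁻¹`, where the truncated logarithm
    -- agrees with `log` but is continuous on the whole line.
    · have hf : Continuous fun x : ℝ => Real.log (max x D⁻¹) :=
        (continuous_id.max continuous_const).log fun x =>
          (lt_max_of_lt_right (inv_pos.2 hD0)).ne'
      refine ((continuous_cfc_hermitianPart hf).comp_aestronglyMeasurable hm).congr ?_
      filter_upwards [hspec] with ω h
      have hsa : star (F ω) = F ω := (hpos ω).1
      simp only [hsa]
      rw [← two_smul ℂ (F ω), smul_smul, inv_mul_cancel₀ two_ne_zero, one_smul]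
      refine cfc_congr fun x hx => ?_
      simp only [max_eq_left (h x hx).2.1]
    -- Every spectrum is nonempty, so `D ≤ 0` is possible only when `ν = 0`.
    · refine (aestronglyMeasurable_const (b := (0 : Matrix n n ℂ))).congr ?_
      filter_upwards [hspec] with ω h
      have h0 : (spectrum ℝ (F ω)) = ∅ :=
        Set.eq_empty_iff_forall_notMem.2 fun x hx => hD0 (h x hx).1
      rw [(hpos ω).1.spectrum_real_eq_range_eigenvalues] at h0
      exact absurd h0 (Set.range_nonempty _).ne_empty
  · filter_upwards [hspec] with ω h
    refine norm_cfc_le (by positivity) fun x hx => ?_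
    obtain ⟨hD0, h1, h2⟩ := h x hx
    have hDi := inv_pos.2 hD0
    have hx0 := hDi.trans_le h1
    have h3 := Real.log_le_log hDi h1
    have h4 := Real.log_le_log hx0 h2
    rw [Real.norm_eq_abs, abs_le]
    constructor
    · linarith [neg_abs_le (Real.log D⁻¹), abs_nonneg (Real.log C)]
    · linarith [le_abs_self (Real.log C), abs_nonneg (Real.log D⁻¹)]

theorem integrable_smul_of_mem_essBounded {F : Ω → Matrix n n ℂ} (hF : F ∈ essBounded n ν)
    (φ : Matrix n n ℂ →ₗ[ℂ] ℂ) {r : Ω → ℝ} (hr : Integrable r ν) :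
    Integrable (fun ω => φ (F ω) * (r ω : ℂ)) ν := by
  obtain ⟨hm, C, hC⟩ := hF
  let ψ := LinearMap.toContinuousLinearMap φ
  refine hr.ofReal.bdd_mul (c := ‖ψ‖ * C) (ψ.continuous.comp_aestronglyMeasurable hm) ?_
  filter_upwards [hC] with ω h
  exact (ψ.le_opNorm _).trans (mul_le_mul_of_nonneg_left h (norm_nonneg _))

end EssBounded

/-! ### Positivity of exponentials and the support condition -/

section MatrixFacts

variable {n : Type*} [Fintype n] [DecidableEq n]

/-- The exponential is the square of the Hermitian invertible matrix `exp (H / 2)`. -/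
theorem Matrix.IsHermitian.posDef_exp {H : Matrix n n ℂ} (hH : H.IsHermitian) :
    (NormedSpace.exp H).PosDef := by
  have hK : ((2⁻¹ : ℂ) • H).IsHermitian := by
    rw [IsHermitian, conjTranspose_smul, hH.eq]
    simp
  have hsq : NormedSpace.exp H =
      (NormedSpace.exp ((2⁻¹ : ℂ) • H))ᴴ * NormedSpace.exp ((2⁻¹ : ℂ) • H) := by
    rw [hK.exp.eq, ← Matrix.exp_add_of_commute _ _ (Commute.refl _), ← two_smul ℂ, smul_smul,
      mul_inv_cancel₀ two_ne_zero, one_smul]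
  rw [hsq]
  refine PosDef.conjTranspose_mul_self _ (mulVec_injective_of_isUnit ?_)
  exact Matrix.isUnit_exp _

/-- Each column of `ρ` lies in the range of `σ`; the preimages are the columns of `K`. -/
theorem exists_eq_mul_of_supp_le {ρ σ : Mat2} (h : supp ρ ≤ supp σ) : ∃ K : Mat2, ρ = σ * K := by
  have hcol : ∀ j, ∃ v : Fin 2 → ℂ, σ *ᵥ v = ρ *ᵥ Pi.single j 1 := fun j =>
    h ⟨Pi.single j 1, rfl⟩
  choose v hv using hcol
  refine ⟨of fun i j => v j i, ?_⟩
  ext i j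
  have := congrFun (hv j) i
  rw [mulVec_single_one] at this
  exact this.symm

end MatrixFacts

namespace RiskSensitive

/-! ### The vacuum state as an isometric embedding -/

section Vacuum

/-- The isometry `ξ ↦ ξ ⊗ Φ^{⊗N}`. -/
def vacuumEmbedding (N : ℕ) : Matrix (Fin 2 × (Fin N → Fin 2)) (Fin 2) ℂ :=
  of fun x i => if x.1 = i then ∏ l, vacuum (x.2 l) else 0

theorem vacuumEmbedding_mul_mul (N : ℕ) (ρ : Mat2) :
    vacuumEmbedding N * ρ * (vacuumEmbedding N)ᴴ = ρ ⊗ₖ vacuumDensity N := by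
  ext ⟨s, f⟩ ⟨s', f'⟩
  simp only [mul_apply, vacuumEmbedding, of_apply, conjTranspose_apply, kroneckerMap_apply,
    vacuumDensity, tensorPow, vecMulVec_apply, Finset.prod_mul_distrib, ite_mul, zero_mul,
    Finset.sum_ite_eq, Finset.mem_univ, if_true, apply_ite star, star_zero, mul_ite, mul_zero,
    star_prod, Pi.star_apply]
  ring

theorem vacuumEmbedding_isometry (N : ℕ) : (vacuumEmbedding N)ᴴ * vacuumEmbedding N = 1 := by
  have hsum : ∑ f : Fin N → Fin 2, (∏ l, star (vacuum (f l)) * vacuum (f l)) = 1 := by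
    have h := Finset.prod_univ_sum (fun _ : Fin N => (Finset.univ : Finset (Fin 2)))
      fun _ j => star (vacuum j) * vacuum j
    rw [Fintype.piFinset_univ] at h
    rw [← h]
    simp [vacuum]
  ext i j
  simp only [mul_apply, vacuumEmbedding, of_apply, conjTranspose_apply, Fintype.sum_prod_type,
    one_apply, apply_ite star, star_zero, mul_ite, ite_mul, zero_mul, mul_zero, star_prod,
    ← Finset.prod_mul_distrib]
  rw [Finset.sum_comm]
  simp only [Finset.sum_ite_eq', Finset.mem_univ, if_true]
  by_cases h : i = j
  · subst h
    simpa using hsum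
  · simp [h, Ne.symm h]

end Vacuum

/-! ### Boundedness and invertibility of the cost operator -/

section Bounded

variable {Ω : Type*} [MeasurableSpace Ω] {ν : Measure Ω} {M : Coeff} {p : Ω → ℝ} {lam : ℝ} {N : ℕ}

theorem aestronglyMeasurable_stepOp
    (hM_meas : ∀ a b : Fin 2, AEMeasurable (fun ω => M.gauge (p ω) a b) ν ∧
      AEMeasurable (fun ω => M.plus (p ω) a b) ν ∧
      AEMeasurable (fun ω => M.minus (p ω) a b) ν ∧
      AEMeasurable (fun ω => M.drift (p ω) a b) ν) (l : ℕ) :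
    AEStronglyMeasurable (stepOp M p lam N l) ν := by
  refine aestronglyMeasurable_matrix fun i j => ?_
  obtain ⟨h1, h2, h3, h4⟩ := hM_meas i.1 j.1
  exact ((((h1.mul_const _).add (h2.mul_const _)).add (h3.mul_const _)).add
    (h4.mul_const _)).const_add _

theorem evol_mem_essBounded
    (hstep : ∀ l, 1 ≤ l → l ≤ N → stepOp M p lam N l ∈ essBounded _ ν) :
    ∀ l, l ≤ N → evol M p lam N l ∈ essBounded _ ν
  | 0, _ => one_mem (essBounded _ ν)
  | l + 1, hl => by
    have h : evol M p lam N (l + 1) = stepOp M p lam N (l + 1) * evol M p lam N l := by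
      rw [stepOp, add_mul, one_mul]; rfl
    rw [h]
    exact mul_mem (hstep _ (Nat.le_add_left 1 l) hl) (evol_mem_essBounded hstep l (by omega))

theorem flow_mem_essBounded {l : ℕ} (hU : evol M p lam N l ∈ essBounded _ ν) {X : TotalAlg Ω N}
    (hX : X ∈ essBounded _ ν) : flow M p lam N l X ∈ essBounded _ ν :=
  mul_mem (mul_mem (star_mem hU) hX) hU

/-- The essentially bounded functions form a unital `*`-algebra, so checking the generators `ΔY(i)`
settles every estimate. -/
theorem obsAlg_le_essBounded (hU : ∀ l, l ≤ N → evol M p lam N l ∈ essBounded _ ν) {l : ℕ}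
    (hl : l ≤ N) : obsAlg M p lam N l ≤ essBounded _ ν := by
  refine StarAlgebra.adjoin_le ?_
  rintro _ ⟨i, -, hi, rfl⟩
  exact flow_mem_essBounded (hU i (hi.trans hl)) (const_mem_essBounded _)

variable {Xe : Mat2} {u : ℕ → TotalAlg Ω N}

theorem sqErr_mem_essBounded (hU : ∀ l, l ≤ N → evol M p lam N l ∈ essBounded _ ν)
    (hu : ∀ l, 1 ≤ l → l ≤ N → u l ∈ obsAlg M p lam N l) {l : ℕ} (hl1 : 1 ≤ l) (hl : l ≤ N) :
    sqErr M p lam N Xe u l ∈ essBounded _ ν := by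
  have h : flow M p lam N l (ofSystem Ω N Xe) - u l ∈ essBounded _ ν :=
    sub_mem (flow_mem_essBounded (hU l hl) (const_mem_essBounded _))
      (obsAlg_le_essBounded hU hl (hu l hl1 hl))
  exact mul_mem (star_mem h) h

omit [MeasurableSpace Ω] in
theorem opExp_mul_opExp_neg (X : TotalAlg Ω N) : opExp X * opExp (-X) = 1 :=
  funext fun ω => Matrix.exp_mul_exp_neg (X ω)

/-- The inverse is the reversed product of exponentials of the negated exponents. Its boundedness
keeps the spectrum of the cost away from `0`, as its logarithm requires. -/
theorem exists_riskOp_inverse (hS : ∀ l, 1 ≤ l → l ≤ N → sqErr M p lam N Xe u l ∈ essBounded _ ν)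
    (mu1 : ℝ) : ∀ l, l ≤ N → riskOp M p lam N Xe u mu1 l ∈ essBounded _ ν ∧
      ∃ G ∈ essBounded (Fin 2 × (Fin N → Fin 2)) ν, riskOp M p lam N Xe u mu1 l * G = 1
  | 0, _ => ⟨one_mem (essBounded _ ν), 1, one_mem (essBounded _ ν), mul_one _⟩
  | 1, _ => ⟨one_mem (essBounded _ ν), 1, one_mem (essBounded _ ν), mul_one _⟩
  | l + 2, hl => by
    obtain ⟨hR, G, hG, hRG⟩ := exists_riskOp_inverse hS mu1 (l + 1) (by omega)
    have hX : ((mu1 / 2 * lam ^ 2 : ℝ) : ℂ) • sqErr M p lam N Xe u (l + 1) ∈ essBounded _ ν :=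
      SMulMemClass.smul_mem _ (hS (l + 1) (by omega) (by omega))
    refine ⟨mul_mem (exp_mem_essBounded hX) hR, _,
      mul_mem hG (exp_mem_essBounded (neg_mem hX)), ?_⟩
    change opExp _ * riskOp M p lam N Xe u mu1 (l + 1) * (G * opExp _) = 1
    rw [mul_assoc, ← mul_assoc (riskOp M p lam N Xe u mu1 (l + 1)), hRG, one_mul]
    exact opExp_mul_opExp_neg _

omit [MeasurableSpace Ω] in
theorem isHermitian_smul_sqErr (c : ℝ) (l : ℕ) (ω : Ω) :
    (((c : ℂ) • sqErr M p lam N Xe u l) ω).IsHermitian := by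
  have h : ((sqErr M p lam N Xe u l) ω).IsHermitian := isHermitian_conjTranspose_mul_self _
  change ((c : ℂ) • sqErr M p lam N Xe u l ω)ᴴ = (c : ℂ) • sqErr M p lam N Xe u l ω
  rw [conjTranspose_smul, h.eq]
  congr 1
  exact Complex.conj_ofReal c

/-- The cost is a congruence of a positive definite exponential by an invertible operator.
Positivity holds in every fibre, since it depends only on the exponents being Hermitian. -/
theorem costOp_spec (hN : 1 ≤ N)
    (hS : ∀ l, 1 ≤ l → l ≤ N → sqErr M p lam N Xe u l ∈ essBounded _ ν) (mu1 mu2 : ℝ) :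
    (∀ ω, (costOp M p lam N Xe u mu1 mu2 ω).PosDef) ∧
      costOp M p lam N Xe u mu1 mu2 ∈ essBounded _ ν ∧
      ∃ G ∈ essBounded (Fin 2 × (Fin N → Fin 2)) ν, costOp M p lam N Xe u mu1 mu2 * G = 1 := by
  obtain ⟨hR, G, hG, hRG⟩ := exists_riskOp_inverse hS mu1 N le_rfl
  have hX : (mu2 : ℂ) • sqErr M p lam N Xe u N ∈ essBounded _ ν :=
    SMulMemClass.smul_mem _ (hS N hN le_rfl)
  refine ⟨fun ω => ?_, mul_mem (mul_mem (star_mem hR) (exp_mem_essBounded hX)) hR, ?_⟩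
  · refine (isHermitian_smul_sqErr mu2 N ω).posDef_exp.conjTranspose_mul_mul_same
      (mulVec_injective_of_isUnit ?_)
    exact IsUnit.of_mul_eq_one _ (congrFun hRG ω)
  · refine ⟨G * opExp (-((mu2 : ℂ) • sqErr M p lam N Xe u N)) * star G,
      mul_mem (mul_mem hG (exp_mem_essBounded (neg_mem hX))) (star_mem hG), ?_⟩
    have hGR : G * riskOp M p lam N Xe u mu1 N = 1 :=
      funext fun ω => mul_eq_one_comm.1 (congrFun hRG ω)
    rw [costOp]
    calc _ = star (riskOp M p lam N Xe u mu1 N) * (opExp ((mu2 : ℂ) • sqErr M p lam N Xe u N) *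
          (riskOp M p lam N Xe u mu1 N * G) *
          opExp (-((mu2 : ℂ) • sqErr M p lam N Xe u N))) * star G := by simp only [mul_assoc]
      _ = 1 := by
        rw [hRG, mul_one, opExp_mul_opExp_neg, mul_one, ← star_mul, hGR, star_one]

end Bounded

/-! ### Expectations in product states -/

section State

variable {Ω : Type*} {N : ℕ}

theorem stateDensity_prodDensity (r : Ω → ℝ) (s : Mat2) (X : TotalAlg Ω N) (ω : Ω) :
    stateDensity (prodDensity r s) X ω =
      (traceLinearMap _ ℂ ℂ ∘ₗ LinearMap.mulRight ℂ (s ⊗ₖ vacuumDensity N)) (X ω) * (r ω : ℂ) := by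
  change (X ω * (((r ω : ℂ) • s) ⊗ₖ vacuumDensity N)).trace =
    (X ω * (s ⊗ₖ vacuumDensity N)).trace * (r ω : ℂ)
  rw [smul_kronecker, Matrix.mul_smul, trace_smul, smul_eq_mul, mul_comm]

theorem stateDensity_eq (ρ : Ω → Mat2) (X : TotalAlg Ω N) (ω : Ω) :
    stateDensity ρ X ω =
      (X ω * (vacuumEmbedding N * ρ ω * (vacuumEmbedding N)ᴴ)).trace := by
  rw [vacuumEmbedding_mul_mul]; rfl

/-- A positive definite operator has positive expectation in a product state. -/
theorem trace_mul_vacuum_pos {s : Mat2} (hs : IsSystemDensity s) {Z : SysField N} (hZ : Z.PosDef) :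
    0 < (Z * (vacuumEmbedding N * s * (vacuumEmbedding N)ᴴ)).trace.re := by
  set L := (cfc Real.log Z * (vacuumEmbedding N * s * (vacuumEmbedding N)ᴴ)).trace.re with hL
  -- With equal states the entropy term vanishes; at `c = exp L` the bound becomes `L ≤ T / exp L -
  -- 1 + L` for the expectation `T`, whence `T ≥ exp L`.
  have h := trace_cfc_log_mul_conj_le hs.1 hs.1 (K := 1) (Matrix.mul_one _).symm
    (vacuumEmbedding_isometry N) hZ (Real.exp_pos L)
  rw [← hL, hs.2, Real.log_exp, sub_self, Matrix.mul_zero, trace_zero] at h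
  simp only [Complex.one_re, Complex.zero_re, one_mul, add_zero] at h
  have h1 : 1 ≤ (Z * (vacuumEmbedding N * s * (vacuumEmbedding N)ᴴ)).trace.re / Real.exp L := by
    linarith
  rw [le_div_iff₀ (Real.exp_pos L), one_mul] at h1
  exact (Real.exp_pos L).trans_le h1

theorem posSemidef_prodDensity {r : Ω → ℝ} {s : Mat2} (hs : IsSystemDensity s) {ω : Ω}
    (hr : 0 ≤ r ω) : (prodDensity r s ω).PosSemidef :=
  hs.1.smul (Complex.zero_le_real.2 hr)

theorem trace_prodDensity_re {r : Ω → ℝ} {s : Mat2} (hs : IsSystemDensity s) (ω : Ω) :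
    (prodDensity r s ω).trace.re = r ω := by
  rw [prodDensity, trace_smul, hs.2, smul_eq_mul, mul_one, Complex.ofReal_re]

theorem isHermitian_prodDensity {s : Mat2} (hs : IsSystemDensity s) (r : Ω → ℝ) (ω : Ω) :
    (prodDensity r s ω).IsHermitian := by
  rw [IsHermitian, prodDensity, conjTranspose_smul, hs.1.1.eq]
  congr 1
  exact Complex.conj_ofReal _

theorem state_eq_ofReal [MeasurableSpace Ω] (ν : Measure Ω) {ρ : Ω → Mat2} {X : TotalAlg Ω N}
    (h : ∀ ω, stateDensity ρ X ω = ((stateDensity ρ X ω).re : ℂ)) :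
    state ν ρ X = ((∫ ω, (stateDensity ρ X ω).re ∂ν : ℝ) : ℂ) := by
  rw [← integral_complex_ofReal]
  exact integral_congr_ae (.of_forall h)

end State

end RiskSensitive

/-! ### Integration over the parameter -/

theorem theorem6p1 {Ω : Type*} [MeasurableSpace Ω] (ν : Measure Ω) [SigmaFinite ν]
    (p : Ω → ℝ) (hp : MemLp p ⊤ ν)
    (N : ℕ) (hN : 1 ≤ N) (lam : ℝ) (hlam : 0 < lam)
    (M : Coeff)
    (hM_meas : ∀ a b : Fin 2, AEMeasurable (fun ω => M.gauge (p ω) a b) ν ∧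
      AEMeasurable (fun ω => M.plus (p ω) a b) ν ∧
      AEMeasurable (fun ω => M.minus (p ω) a b) ν ∧
      AEMeasurable (fun ω => M.drift (p ω) a b) ν)
    (hM_unitary : ∀ l, 1 ≤ l → l ≤ N → ∀ᵐ ω ∂ν,
      stepOp M p lam N l ω ∈ unitary (SysField N))
    (Xe : Mat2) (mu1 mu2 : ℝ)
    (rTrue rNom : Ω → ℝ) (hrTrue : IsParamDensity ν rTrue) (hrNom : IsParamDensity ν rNom)
    (sTrue sNom : Mat2) (hsTrue : IsSystemDensity sTrue) (hsNom : IsSystemDensity sNom)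
    (hfin : relEntropy ν (prodDensity rTrue sTrue) (prodDensity rNom sNom) < ⊤)
    (u : ℕ → TotalAlg Ω N) (hu : ∀ l, 1 ≤ l → l ≤ N → u l ∈ obsAlg M p lam N l) :
    (∀ᵐ ω ∂ν, (costOp M p lam N Xe u mu1 mu2 ω).PosDef) ∧
    Integrable (stateDensity (prodDensity rTrue sTrue)
      (opLog (costOp M p lam N Xe u mu1 mu2))) ν ∧
    Integrable (stateDensity (prodDensity rNom sNom) (costOp M p lam N Xe u mu1 mu2)) ν ∧
    ∃ a b : ℝ,
      state ν (prodDensity rTrue sTrue) (opLog (costOp M p lam N Xe u mu1 mu2)) = (a : ℂ) ∧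
      state ν (prodDensity rNom sNom) (costOp M p lam N Xe u mu1 mu2) = (b : ℂ) ∧
      0 < b ∧
      (a : EReal) ≤ (Real.log b : EReal) +
        relEntropy ν (prodDensity rTrue sTrue) (prodDensity rNom sNom) := by
  have hU := evol_mem_essBounded (ν := ν) fun l h1 hl =>
    mem_essBounded_of_ae_unitary (aestronglyMeasurable_stepOp hM_meas l) (hM_unitary l h1 hl)
  obtain ⟨hZpos, hZ, G, hG, hZG⟩ := costOp_spec (Xe := Xe) hN
    (fun l h1 hl => sqErr_mem_essBounded hU hu h1 hl) mu1 mu2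
  set Z := costOp M p lam N Xe u mu1 mu2 with hZdef
  have hlog : opLog Z ∈ essBounded _ ν := cfc_log_mem_essBounded hZ hG hZG hZpos
  have hintT : Integrable (stateDensity (prodDensity rTrue sTrue) (opLog Z)) ν := by
    rw [funext (stateDensity_prodDensity rTrue sTrue (opLog Z))]
    exact integrable_smul_of_mem_essBounded hlog _ hrTrue.1
  have hintN : Integrable (stateDensity (prodDensity rNom sNom) Z) ν := by
    rw [funext (stateDensity_prodDensity rNom sNom Z)]
    exact integrable_smul_of_mem_essBounded hZ _ hrNom.1
  have hT := state_eq_ofReal ν (ρ := prodDensity rTrue sTrue) (X := opLog Z) fun ω => by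
    rw [stateDensity_eq, opLog, trace_cfc_mul_conj_eq (isHermitian_prodDensity hsTrue rTrue ω)
      (hZpos ω).1, Complex.ofReal_re]
  have hNm := state_eq_ofReal ν (ρ := prodDensity rNom sNom) (X := Z) fun ω => by
    rw [stateDensity_eq, trace_mul_conj_eq (isHermitian_prodDensity hsNom rNom ω)
      (hZpos ω).1, Complex.ofReal_re]
  have hNre : ∀ ω, (stateDensity (prodDensity rNom sNom) Z ω).re =
      (Z ω * (vacuumEmbedding N * sNom * (vacuumEmbedding N)ᴴ)).trace.re * rNom ω := by
    intro ω
    rw [stateDensity_prodDensity, Complex.re_mul_ofReal, vacuumEmbedding_mul_mul]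
    rfl
  have hNnonneg : 0 ≤ᵐ[ν] fun ω => (stateDensity (prodDensity rNom sNom) Z ω).re := by
    filter_upwards [hrNom.2.1] with ω h
    rw [Pi.zero_apply, hNre]
    exact mul_nonneg (trace_mul_vacuum_pos hsNom (hZpos ω)).le h
  set b := ∫ ω, (stateDensity (prodDensity rNom sNom) Z ω).re ∂ν with hb
  have hbpos : 0 < b := by
    -- The integrand is `rNom` times a strictly positive factor, so a zero integral would force
    -- `rNom = 0` a.e., against its total mass `1`.
    refine (integral_nonneg_of_ae hNnonneg).lt_of_ne' fun h0 => ?_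
    rw [integral_eq_zero_iff_of_nonneg_ae hNnonneg hintN.re] at h0
    have hr0 : rNom =ᵐ[ν] 0 := by
      filter_upwards [h0] with ω h
      rw [hNre] at h
      exact (mul_eq_zero.1 h).resolve_left (trace_mul_vacuum_pos hsNom (hZpos ω)).ne'
    have h1 := hrNom.2.2
    rw [integral_congr_ae hr0] at h1
    simp at h1
  refine ⟨.of_forall hZpos, hintT, hintN, _, b, hT, hNm, hbpos, ?_⟩
  rw [relEntropy] at hfin ⊢
  split_ifs at hfin ⊢ with hcond
  · obtain ⟨hsupp, hent⟩ := hcond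
    rw [← EReal.coe_add, EReal.coe_le_coe_iff]
    -- The same constant `c = b` serves every fibre; after integration, `b / b` cancels the total
    -- mass of `rTrue` and `log b` plus the relative entropy is left.
    have hle : ∀ᵐ ω ∂ν, (stateDensity (prodDensity rTrue sTrue) (opLog Z) ω).re ≤
        (stateDensity (prodDensity rNom sNom) Z ω).re / b - rTrue ω + rTrue ω * Real.log b +
          relEntropyDensity (prodDensity rTrue sTrue) (prodDensity rNom sNom) ω := by
      filter_upwards [hsupp, hrTrue.2.1, hrNom.2.1] with ω h h1 h2
      obtain ⟨K, hK⟩ := exists_eq_mul_of_supp_le h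
      have := trace_cfc_log_mul_conj_le (posSemidef_prodDensity hsTrue h1)
        (posSemidef_prodDensity hsNom h2) hK (vacuumEmbedding_isometry N) (hZpos ω) hbpos
      rw [trace_prodDensity_re hsTrue] at this
      rw [stateDensity_eq, stateDensity_eq]
      exact this
    have hi1 : Integrable (fun ω => (stateDensity (prodDensity rNom sNom) Z ω).re / b) ν :=
      hintN.re.div_const b
    have hi2 := hi1.sub hrTrue.1
    have hi3 := hi2.add (hrTrue.1.mul_const (Real.log b))
    refine (integral_mono_ae hintT.re (hi3.add hent) hle).trans (le_of_eq ?_)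
    rw [integral_add' hi3 hent, integral_add' hi2 (hrTrue.1.mul_const _),
      integral_sub' hi1 hrTrue.1, integral_div, integral_mul_const, hrTrue.2.2, ← hb,
      div_self hbpos.ne']
    ring
  · exact absurd hfin (lt_irrefl _)
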